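/- Let $\varphi(q)=\sum_{k=-\infty}^{\infty}q^{k^2}$ be Ramanujan's theta function, and define integers $ph_3(n)$, $n\ge 0$, by the formal power series identity $$\sum_{n\ge 0}ph_3(n)\,q^n=\frac{\varphi(-q^3)}{\varphi(-q)}.$$ Then for all integers $m\ge 1$ and $n\ge 0$, $$ph_3\big(3^{2m+1}n\big)\equiv ph_3\big(3^{2m-1}n\big)\pmod{3^{m+2}}.$$ -/

import Mathlib

open scoped PowerSeries

/-- Ramanujan's theta function `φ(q) = ∑_{k ∈ ℤ} q^(k^2)`, as a formal power series in `q`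
with integer coefficients: the coefficient of `q^n` is the number of `k ∈ ℤ` with `k^2 = n`. -/
noncomputable def ramanujanPhi : ℤ⟦X⟧ :=
  PowerSeries.mk fun n => ({k : ℤ | k ^ 2 = (n : ℤ)}.ncard : ℤ)

/-- The index sets counted in `ramanujanPhi` are finite. -/
theorem finite_setOf_sq_eq (n : ℕ) : {k : ℤ | k ^ 2 = (n : ℤ)}.Finite := by
  refine (Set.finite_Icc (-(n : ℤ)) (n : ℤ)).subset ?_
  intro k hk
  have hk' : k ^ 2 = (n : ℤ) := hk
  constructor <;> nlinarith [sq_nonneg (k - 1), sq_nonneg (k + 1), Int.le_self_sq k,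
    Int.le_self_sq (-k)]

/-- `φ(-q)`. -/
noncomputable def phiNeg : ℤ⟦X⟧ :=
  PowerSeries.rescale (-1 : ℤ) ramanujanPhi

/-- `φ(-q^3)`, that is `φ(-q)` with `q` replaced by `q^3`. -/
noncomputable def phiNegCube : ℤ⟦X⟧ :=
  PowerSeries.expand 3 (by norm_num) phiNeg

theorem constantCoeff_phiNeg : PowerSeries.constantCoeff phiNeg = ((1 : ℤˣ) : ℤ) := by
  have h : {k : ℤ | k ^ 2 = ((0 : ℕ) : ℤ)} = {0} := by
    ext k; simp
  rw [← PowerSeries.coeff_zero_eq_constantCoeff_apply, phiNeg, PowerSeries.coeff_rescale,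
    ramanujanPhi, PowerSeries.coeff_mk, h]
  simp

/-- The generating function `φ(-q^3) / φ(-q)`; the denominator has constant term `1`,
so it is invertible in `ℤ⟦X⟧`. -/
noncomputable def ph3Series : ℤ⟦X⟧ :=
  phiNegCube * PowerSeries.invOfUnit phiNeg 1

/-- `ph3Series` is indeed the quotient of `φ(-q^3)` by `φ(-q)`. -/
theorem ph3Series_mul_phiNeg : ph3Series * phiNeg = phiNegCube := by
  rw [ph3Series, mul_assoc, PowerSeries.invOfUnit_mul phiNeg 1 constantCoeff_phiNeg, mul_one]

/-- `ph_3(n)`, the coefficient of `q^n` in `φ(-q^3) / φ(-q)`. -/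
noncomputable def ph3 (n : ℕ) : ℤ :=
  PowerSeries.coeff n ph3Series

/-!
Put `P = φ(-q^3) / φ(-q)` and let `U_3` be Atkin's operator `∑ a(n) q^n ↦ ∑ a(3n) q^n`, so that
`ph_3(3^k n)` is the `n`-th coefficient of `U_3^k P`.

Separating the exponents of `φ(-q)` modulo `3` gives `φ(-q) = φ(-q^9) - B` with `B ∈ q ℤ⟦q^3⟧`.
The norm of `φ(-q)` over the cube roots of unity is therefore `φ(-q^9)^3 - B^3`, while Gauss's
product for `φ(-q)` evaluates it as `φ(-q^3)^4 / φ(-q^9)`. This is a cubic equation for `P` over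
`ℤ[P(q^3)]`, and it implies one for the Hauptmodul `s = P^4 - 1`. These equations determine `U_3`
on powers of `P` recursively, starting from `U_3(P⁻¹) = P` and `U_3(P⁻²) = P^2`, and show that `U_3`
maps each of `P ℤ[s]` and `P^3 ℤ[s]` into the other.

Give `3` the weight `2` and `s` the weight `-3`. Then `U_3` raises weights by at least `2` from
`P s ℤ[s]` to `P^3 s ℤ[s]` and does not lower them from `P^3 s ℤ[s]` to `P s ℤ[s]`. So every
application of `U_3^2` to `U_3^3 P - U_3 P = 9 U_3(P s + P s^2)`, which has weight at least `5` and
is thus divisible by `27`, gains another factor `3`.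
-/

open PowerSeries

section AtkinU

variable {R : Type*} [CommRing R]

/-- Atkin's operator `U_p : ∑ a(n) q^n ↦ ∑ a(pn) q^n` on formal power series. -/
noncomputable def atkinU (p : ℕ) : R⟦X⟧ →ₗ[R] R⟦X⟧ where
  toFun f := mk fun n => coeff (p * n) f
  map_add' f g := by ext; simp
  map_smul' a f := by ext; simp

theorem coeff_atkinU (p : ℕ) (f : R⟦X⟧) (n : ℕ) : coeff n (atkinU p f) = coeff (p * n) f := by
  simp [atkinU]

theorem coeff_atkinU_pow (p k n : ℕ) (f : R⟦X⟧) :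
    coeff n ((atkinU p ^ k) f) = coeff (p ^ k * n) f := by
  induction k generalizing n with
  | zero => simp
  | succ k ih => rw [pow_succ', Module.End.mul_apply, coeff_atkinU, ih, ← mul_assoc, ← pow_succ]

theorem atkinU_expand_mul (p : ℕ) (hp : p ≠ 0) (f g : R⟦X⟧) :
    atkinU p (expand p hp f * g) = f * atkinU p g := by
  ext n
  rw [coeff_atkinU, coeff_mul, coeff_mul]
  refine (Finset.sum_of_injOn (fun x => (p * x.1, p * x.2)) ?_ ?_ ?_ ?_).symm
  · rintro ⟨a, b⟩ _ ⟨c, d⟩ _ h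
    simpa [hp] using h
  · rintro ⟨a, b⟩ h
    simp only [Finset.mem_coe, Finset.HasAntidiagonal.mem_antidiagonal] at h ⊢
    rw [← mul_add, h]
  · rintro ⟨a, b⟩ h h'
    rw [Finset.HasAntidiagonal.mem_antidiagonal] at h
    rw [coeff_expand_of_not_dvd, zero_mul]
    rintro ⟨c, rfl⟩
    obtain ⟨d, rfl⟩ : p ∣ b := (Nat.dvd_add_right (Dvd.intro c rfl)).mp ⟨n, h⟩
    refine h' ⟨(c, d), ?_, rfl⟩
    simpa [← mul_add, hp] using h
  · rintro ⟨a, b⟩ _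
    rw [coeff_expand_mul, coeff_atkinU]

theorem atkinU_one {p : ℕ} (hp : p ≠ 0) : atkinU p (1 : R⟦X⟧) = 1 := by
  ext n
  simp [coeff_atkinU, coeff_one, hp]

theorem atkinU_mul_pow_add_three {p : ℕ} {hp : p ≠ 0} {a b c y : R⟦X⟧}
    (hy : y ^ 3 = expand p hp a * y ^ 2 + expand p hp b * y + expand p hp c) (x : R⟦X⟧) (k : ℕ) :
    atkinU p (x * y ^ (k + 3)) = a * atkinU p (x * y ^ (k + 2)) + b * atkinU p (x * y ^ (k + 1)) +
      c * atkinU p (x * y ^ k) := by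
  simp only [← atkinU_expand_mul p hp, ← map_add]
  congr 1
  linear_combination x * y ^ k * hy

theorem rescale_eq_C_pow_mul {p r : ℕ} {z : R} (hz : z ^ p = 1) {f : R⟦X⟧}
    (hf : ∀ n, n % p ≠ r → coeff n f = 0) : rescale z f = C (z ^ r) * f := by
  ext n
  rw [coeff_rescale, coeff_C_mul]
  by_cases h : n % p = r
  · rw [← Nat.mod_add_div n p, h, pow_add, pow_mul, hz, one_pow, mul_one]
  · rw [hf n h, mul_zero, mul_zero]

theorem mul_rescale_mul_rescale_sub {w : R} (hw : w ^ 2 + w + 1 = 0) {f g : R⟦X⟧}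
    (hf : ∀ n, n % 3 ≠ 0 → coeff n f = 0) (hg : ∀ n, n % 3 ≠ 1 → coeff n g = 0) :
    (f - g) * rescale w (f - g) * rescale (w ^ 2) (f - g) = f ^ 3 - g ^ 3 := by
  have hw3 : w ^ 3 = 1 := by linear_combination (w - 1) * hw
  have hw6 : (w ^ 2) ^ 3 = 1 := by rw [pow_right_comm, hw3, one_pow]
  have hC : (C w : R⟦X⟧) ^ 2 + C w + 1 = 0 := by
    simpa only [map_add, map_pow, map_one, map_zero] using congrArg (C : R →+* R⟦X⟧) hw
  simp only [map_sub, rescale_eq_C_pow_mul hw3 hf, rescale_eq_C_pow_mul hw3 hg,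
    rescale_eq_C_pow_mul hw6 hf, rescale_eq_C_pow_mul hw6 hg, map_pow, map_one, pow_zero,
    pow_one, one_mul]
  linear_combination (f * g ^ 2 * C w - f ^ 2 * g - g ^ 3 * (C w - 1)) * hC

end AtkinU

section Theta

theorem coeff_phiNeg (n : ℕ) :
    coeff n phiNeg = (-1) ^ n * ({k : ℤ | k ^ 2 = (n : ℤ)}.ncard : ℤ) := by
  simp [phiNeg, ramanujanPhi, coeff_rescale]

theorem coeff_phiNeg_of_forall_sq_ne {n : ℕ} (h : ∀ k : ℤ, k ^ 2 ≠ n) : coeff n phiNeg = 0 := by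
  simp [coeff_phiNeg, h]

theorem coeff_phiNeg_nine_mul (n : ℕ) : coeff (3 * (3 * n)) phiNeg = coeff n phiNeg := by
  have h : {k : ℤ | k ^ 2 = ((3 * (3 * n) : ℕ) : ℤ)} = (3 * ·) '' {k : ℤ | k ^ 2 = (n : ℤ)} := by
    ext k
    simp only [Set.mem_ofPred_eq, Set.mem_image]
    push_cast
    constructor
    · intro hk
      obtain ⟨l, rfl⟩ := Int.prime_three.dvd_of_dvd_pow (Dvd.intro _ hk.symm)
      exact ⟨l, by linarith, rfl⟩
    · rintro ⟨l, hl, rfl⟩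
      linarith
  rw [coeff_phiNeg, coeff_phiNeg, h,
    Set.ncard_image_of_injective _ (mul_right_injective₀ three_ne_zero), pow_mul, pow_mul]
  norm_num

theorem atkinU_phiNeg : atkinU 3 phiNeg = phiNegCube := by
  ext n
  rw [coeff_atkinU, phiNegCube]
  by_cases h : 3 ∣ n
  · obtain ⟨m, rfl⟩ := h
    rw [coeff_expand_mul, coeff_phiNeg_nine_mul]
  · rw [coeff_expand_of_not_dvd _ _ _ h, coeff_phiNeg_of_forall_sq_ne]
    intro k hk
    push_cast at hk
    obtain ⟨l, rfl⟩ := Int.prime_three.dvd_of_dvd_pow (Dvd.intro _ hk.symm)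
    exact h (by zify; exact ⟨l ^ 2, by linarith⟩)

theorem coeff_phiNeg_of_mod_three_eq_two {n : ℕ} (hn : n % 3 = 2) : coeff n phiNeg = 0 := by
  refine coeff_phiNeg_of_forall_sq_ne fun k hk => ?_
  have hk2 : k ^ 2 % 3 = 2 := by omega
  rcases (by omega : k % 3 = 0 ∨ k % 3 = 1 ∨ k % 3 = 2) with h | h | h <;>
    simp [sq, Int.mul_emod, h] at hk2

theorem coeff_expand_phiNegCube_sub_phiNeg {n : ℕ} (hn : n % 3 ≠ 1) :
    coeff n (expand 3 three_ne_zero phiNegCube - phiNeg) = 0 := by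
  rw [map_sub, sub_eq_zero]
  by_cases h : 3 ∣ n
  · obtain ⟨m, rfl⟩ := h
    rw [coeff_expand_mul, ← atkinU_phiNeg, coeff_atkinU]
  · rw [coeff_expand_of_not_dvd _ _ _ h, coeff_phiNeg_of_mod_three_eq_two (by omega)]

theorem atkinU_phiNeg_sq : atkinU 3 (phiNeg ^ 2) = phiNegCube ^ 2 := by
  set A := expand 3 three_ne_zero phiNegCube with hA
  have hU : atkinU 3 A = phiNegCube := by
    rw [hA, ← mul_one (expand _ _ _), atkinU_expand_mul, atkinU_one three_ne_zero, mul_one]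
  have hsq : atkinU 3 ((A - phiNeg) ^ 2) = 0 := by
    ext n
    rw [coeff_atkinU, sq, coeff_mul, map_zero]
    refine Finset.sum_eq_zero fun x hx => ?_
    rw [Finset.HasAntidiagonal.mem_antidiagonal] at hx
    by_cases h : x.1 % 3 = 1
    · rw [coeff_expand_phiNegCube_sub_phiNeg (n := x.2) (by omega), mul_zero]
    · rw [coeff_expand_phiNegCube_sub_phiNeg h, zero_mul]
  have hexp : phiNeg ^ 2 = (A - phiNeg) ^ 2 + A * (2 * phiNeg - A) := by ring
  rw [hexp, map_add, hsq, atkinU_expand_mul, map_sub, hU, two_mul, map_add, atkinU_phiNeg]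
  ring

end Theta

section Gauss

open Finset Filter Topology WithPiTopology

/-- Shanks's finite form of Gauss's identity `φ(-q) ∏ (1 + q^k) = ∏ (1 - q^k)`: the error term is
divisible by `x ^ (n + 1)`. -/
theorem partialTheta_mul_prod {R : Type*} [CommRing R] (x : R) (n : ℕ) :
    (2 * ∑ k ∈ range (n + 1), (-1) ^ k * x ^ k ^ 2 - 1) * ∏ k ∈ range n, (1 + x ^ (k + 1)) =
      ∏ k ∈ range n, (1 - x ^ (k + 1)) +
        2 * ∑ s ∈ range n, (-1) ^ (s + 1) * x ^ ((s + 1) * (n + 1)) *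
          ((∏ k ∈ Ico (s + 1) n, (1 - x ^ (k + 1))) * ∏ k ∈ range s, (1 + x ^ (k + 1))) := by
  induction n with
  | zero => norm_num
  | succ n ih =>
    let U (s : ℕ) := (-1) ^ s * x ^ ((s + 1) * (n + 1)) *
      ((∏ k ∈ Ico s n, (1 - x ^ (k + 1))) * ∏ k ∈ range s, (1 + x ^ (k + 1)))
    let V (n s : ℕ) := (-1) ^ (s + 1) * x ^ ((s + 1) * (n + 1)) *
      ((∏ k ∈ Ico (s + 1) n, (1 - x ^ (k + 1))) * ∏ k ∈ range s, (1 + x ^ (k + 1)))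
    have hV (s : ℕ) (hs : s ∈ range n) :
        V (n + 1) s - (1 + x ^ (n + 1)) * V n s = U s - U (s + 1) := by
      replace hs := mem_range.mp hs
      simp only [U, V]
      rw [prod_Ico_succ_top (by omega), prod_eq_prod_Ico_succ_bot hs, prod_range_succ]
      ring
    have htel := sum_congr rfl hV
    rw [sum_range_sub', sum_sub_distrib, ← mul_sum] at htel
    have hn : V (n + 1) n = - (x ^ (n + 1) * U n) := by simp only [U, V, Ico_self]; ring
    have h0 : U 0 = x ^ (n + 1) * ∏ k ∈ range n, (1 - x ^ (k + 1)) := by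
      simp [U]
    have hU : U n = (-1) ^ n * x ^ (n + 1) ^ 2 * ∏ k ∈ range n, (1 + x ^ (k + 1)) := by
      simp [U, sq]
    change _ = _ + 2 * ∑ s ∈ range n, V n s at ih
    change _ = _ + 2 * ∑ s ∈ range (n + 1), V (n + 1) s
    rw [sum_range_succ _ n, sum_range_succ _ (n + 1), prod_range_succ, prod_range_succ, hn]
    linear_combination (1 + x ^ (n + 1)) * ih - 2 * htel - 2 * h0 + 2 * (1 + x ^ (n + 1)) * hU

section Topology

variable {R S : Type*} [CommRing R] [TopologicalSpace R] [CommRing S] [TopologicalSpace S]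

theorem continuous_of_continuous_coeff {Y : Type*} [TopologicalSpace Y] {F : Y → R⟦X⟧}
    (hF : ∀ n, Continuous fun y => coeff n (F y)) : Continuous F :=
  continuous_iff_continuousAt.mpr fun _ =>
    (tendsto_iff_coeff_tendsto R _ _ _).mpr fun n => (hF n).continuousAt

theorem continuous_rescale [IsTopologicalRing R] (a : R) : Continuous (rescale a) :=
  continuous_of_continuous_coeff fun n => by
    simpa only [coeff_rescale] using (continuous_coeff R n).const_mul (a ^ n)

theorem continuous_expand (p : ℕ) (hp : p ≠ 0) : Continuous (expand p hp : R⟦X⟧ → R⟦X⟧) :=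
  continuous_of_continuous_coeff fun n => by
    simp only [coeff_expand]
    split_ifs
    exacts [continuous_coeff R _, continuous_const]

theorem continuous_powerSeries_map {f : R →+* S} (hf : Continuous f) :
    Continuous (PowerSeries.map f) :=
  continuous_of_continuous_coeff fun n => by
    simpa only [coeff_map, Function.comp_def] using hf.comp (continuous_coeff R n)

theorem tendsto_zero_of_X_pow_dvd {f : ℕ → R⟦X⟧} (hf : ∀ n, X ^ n ∣ f n) :
    Tendsto f atTop (𝓝 0) := by
  refine (tendsto_iff_coeff_tendsto R _ _ _).mpr fun d =>
    tendsto_atTop_of_eventually_const (i₀ := d + 1) fun n hn => ?_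
  rw [map_zero, X_pow_dvd_iff.mp (hf n) d hn]

/-- The `q`-Pochhammer symbol `(-c f; f)_∞ = ∏_{k ≥ 1} (1 + c f ^ k)`, as an infinite product in the
topology of coefficientwise convergence. It converges when `f` has no constant term, and otherwise
the value may be junk. -/
noncomputable def qProduct (c : ℤ) (f : R⟦X⟧) : R⟦X⟧ :=
  ∏' k : ℕ, (1 + c * f ^ (k + 1))

theorem hasProd_qProduct (c : ℤ) {f : R⟦X⟧} (hf : X ∣ f) :
    HasProd (fun k : ℕ => 1 + c * f ^ (k + 1)) (qProduct c f) := by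
  refine (multipliable_one_add_of_tendsto_order_atTop_nhds_top R ?_).hasProd
  refine ENat.tendsto_nhds_top_iff_natCast_lt.mpr fun n =>
    eventually_atTop.mpr ⟨n, fun k hk => lt_of_lt_of_le (b := ((k + 1 : ℕ) : ℕ∞)) ?_ ?_⟩
  · exact_mod_cast Nat.lt_succ_of_le hk
  · exact nat_le_order _ _ fun d hd =>
      X_pow_dvd_iff.mp ((pow_dvd_pow_of_dvd hf (k + 1)).mul_left _) d hd

theorem map_qProduct [T2Space S] (F : R⟦X⟧ →+* S⟦X⟧) (hF : Continuous F) (c : ℤ) {f : R⟦X⟧}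
    (hf : X ∣ f) : F (qProduct c f) = qProduct c (F f) := by
  rw [qProduct, (hasProd_qProduct c hf).multipliable.map_tprod F hF]
  simp only [map_add, map_one, map_mul, map_intCast, map_pow, qProduct]

theorem qProduct_ne_zero [T2Space R] [Nontrivial R] (c : ℤ) {f : R⟦X⟧} (hf : X ∣ f) :
    qProduct c f ≠ 0 := by
  have h : constantCoeff (qProduct c f) = 1 := by
    rw [qProduct, (hasProd_qProduct c hf).multipliable.map_tprod _ (continuous_constantCoeff R)]
    simp [X_dvd_iff.mp hf]
  intro h0
  simp [h0] at h

end Topology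

theorem hasSum_phiNeg : HasSum (fun k : ℤ => (-1) ^ k.natAbs * X ^ k.natAbs ^ 2) phiNeg := by
  refine (hasSum_iff_hasSum_coeff ℤ).mpr fun d => ?_
  let s := (finite_setOf_sq_eq d).toFinset
  have hmem (k : ℤ) : k ∈ s ↔ d = k.natAbs ^ 2 := by
    simp only [s, Set.Finite.mem_toFinset, Set.mem_ofPred_eq]
    zify
    rw [sq_abs, eq_comm]
  have hcoeff (k : ℤ) :
      coeff d ((-1) ^ k.natAbs * X ^ k.natAbs ^ 2 : ℤ⟦X⟧) = if k ∈ s then (-1) ^ d else 0 := by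
    rw [show ((-1) ^ k.natAbs : ℤ⟦X⟧) = C ((-1) ^ k.natAbs) by simp, coeff_C_mul, coeff_X_pow,
      mul_ite, mul_one, mul_zero]
    refine if_ctx_congr (hmem k).symm (fun hk => ?_) fun _ => rfl
    rw [(hmem k).mp hk]
    exact neg_one_pow_congr (by simp [Nat.even_pow])
  have hsum : ∑ k ∈ s, coeff d ((-1) ^ k.natAbs * X ^ k.natAbs ^ 2 : ℤ⟦X⟧) = coeff d phiNeg := by
    rw [sum_congr rfl fun k hk => (hcoeff k).trans (if_pos hk), sum_const, coeff_phiNeg,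
      Set.ncard_eq_toFinset_card _ (finite_setOf_sq_eq d), nsmul_eq_mul, mul_comm]
  exact hsum ▸ hasSum_sum_of_ne_finset_zero fun k hk => (hcoeff k).trans (if_neg hk)

theorem phiNeg_mul_qProduct_one : phiNeg * qProduct 1 X = qProduct (-1) X := by
  have hsum : HasSum (fun k : ℕ => 2 * ((-1) ^ k * X ^ k ^ 2)) (phiNeg + 1) := by
    convert! hasSum_phiNeg.nat_add_neg using 2 <;> simp [two_mul]
  have htheta : Tendsto (fun n => 2 * ∑ k ∈ range (n + 1), (-1) ^ k * X ^ k ^ 2 - 1) atTop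
      (𝓝 phiNeg) := by
    simpa only [mul_sum, add_sub_cancel_right] using
      ((tendsto_add_atTop_iff_nat 1).mpr hsum.tendsto_sum_nat).sub_const 1
  have hprod (c : ℤ) := (hasProd_qProduct c (dvd_refl (X : ℤ⟦X⟧))).tendsto_prod_nat
  have hdiff : Tendsto (fun n => (2 * ∑ k ∈ range (n + 1), (-1) ^ k * X ^ k ^ 2 - 1) *
      ∏ k ∈ range n, (1 + ((1 : ℤ) : ℤ⟦X⟧) * X ^ (k + 1)) -
      ∏ k ∈ range n, (1 + ((-1 : ℤ) : ℤ⟦X⟧) * X ^ (k + 1))) atTop (𝓝 0) := by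
    refine tendsto_zero_of_X_pow_dvd fun n => ?_
    push_cast
    simp only [one_mul, neg_one_mul, ← sub_eq_add_neg, partialTheta_mul_prod, add_sub_cancel_left]
    refine (dvd_sum fun s _ => Dvd.dvd.mul_right (Dvd.dvd.mul_left ?_ _) _).mul_left _
    exact pow_dvd_pow X (by nlinarith)
  exact sub_eq_zero.mp (tendsto_nhds_unique ((htheta.mul (hprod 1)).sub (hprod (-1))) hdiff)

theorem map_phiNeg_mul_qProduct_one {R : Type*} [CommRing R] [TopologicalSpace R] [T2Space R]
    (F : ℤ⟦X⟧ →+* R⟦X⟧) (hF : Continuous F) :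
    F phiNeg * qProduct 1 (F X) = qProduct (-1) (F X) := by
  rw [← map_qProduct F hF _ dvd_rfl, ← map_qProduct F hF _ dvd_rfl, ← map_mul,
    phiNeg_mul_qProduct_one]

end Gauss

section CubicRelation

open WithPiTopology

theorem hasProd_ite_three_dvd {M : Type*} [CommMonoid M] [TopologicalSpace M] {f : ℕ → M} {a : M}
    (h : HasProd (fun k => f (3 * (k + 1))) a) :
    HasProd (fun k => if 3 ∣ k + 1 then f (k + 1) else 1) a := by
  have hinj : Function.Injective fun k => 3 * k + 2 := fun a b h => by simpa using h
  refine (hinj.hasProd_iff fun k hk => if_neg ?_).mp ?_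
  · rintro ⟨j, hj⟩
    exact hk ⟨j - 1, by grind⟩
  · simpa only [Function.comp_def, show ∀ k, 3 * k + 2 + 1 = 3 * (k + 1) by grind,
      dvd_mul_right, if_true] using h

theorem one_add_mul_one_add_mul_one_add {R : Type*} [CommRing R] {w c x : R}
    (hw : w ^ 2 + w + 1 = 0) (hc : c ^ 3 = c) :
    (1 + c * x) * (1 + c * (w * x)) * (1 + c * (w ^ 2 * x)) = 1 + c * x ^ 3 := by
  linear_combination (c * x + c ^ 2 * x ^ 2 * w + c ^ 3 * x ^ 3 * (w - 1)) * hw + x ^ 3 * hc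

theorem sq_pow_add_pow_add_one {R : Type*} [CommRing R] {w : R} (hw : w ^ 2 + w + 1 = 0) {n : ℕ}
    (hn : ¬ 3 ∣ n) : (w ^ n) ^ 2 + w ^ n + 1 = 0 := by
  have hw3 : w ^ 3 = 1 := by linear_combination (w - 1) * hw
  rw [pow_eq_pow_mod n hw3]
  obtain h | h : n % 3 = 1 ∨ n % 3 = 2 := by omega
  · rwa [h, pow_one]
  · rw [h]
    linear_combination hw + w * hw3

/-- The norm of `(-c f; f)_∞` over the cube roots of unity. -/
theorem qProduct_mul_qProduct_mul_qProduct {R : Type*} [CommRing R] [TopologicalSpace R]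
    [IsTopologicalRing R] [T2Space R] {w : R⟦X⟧} (hw : w ^ 2 + w + 1 = 0) {c : ℤ} (hc : c ^ 3 = c)
    {f : R⟦X⟧} (hf : X ∣ f) :
    qProduct c f * qProduct c (w * f) * qProduct c (w ^ 2 * f) * qProduct c (f ^ 9) =
      qProduct c (f ^ 3) ^ 4 := by
  have hw3 : w ^ 3 = 1 := by linear_combination (w - 1) * hw
  have hf3 := hasProd_qProduct c (dvd_pow hf three_ne_zero)
  have hf9 := hasProd_qProduct c (dvd_pow hf (by norm_num : 9 ≠ 0))
  have hcube : HasProd (fun k => if 3 ∣ k + 1 then (1 + (c : R⟦X⟧) * f ^ (k + 1)) ^ 3 else 1)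
      (qProduct c (f ^ 3) ^ 3) :=
    hasProd_ite_three_dvd (f := fun k => (1 + (c : R⟦X⟧) * f ^ k) ^ 3) (by
      simpa only [pow_mul] using hf3.pow 3)
  have hnine : HasProd (fun k => if 3 ∣ k + 1 then 1 + (c : R⟦X⟧) * f ^ (3 * (k + 1)) else 1)
      (qProduct c (f ^ 9)) :=
    hasProd_ite_three_dvd (f := fun k => 1 + (c : R⟦X⟧) * f ^ (3 * k)) (by
      simpa only [pow_mul, ← pow_mul f 3 3, Nat.reduceMul] using hf9)
  have hl := (((hasProd_qProduct c hf).mul (hasProd_qProduct c (hf.mul_left w))).mul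
    (hasProd_qProduct c (hf.mul_left (w ^ 2)))).mul hnine
  have hr := hf3.mul hcube
  rw [← pow_succ'] at hr
  refine hl.unique (hr.congr_fun fun k => ?_)
  simp only [mul_pow, ← pow_mul, mul_comm _ (k + 1)]
  simp only [pow_mul]
  split_ifs with h
  · obtain ⟨m, hm⟩ := h
    rw [hm, pow_mul w, hw3, one_pow]
    ring
  · rw [mul_one, mul_one]
    exact one_add_mul_one_add_mul_one_add (sq_pow_add_pow_add_one hw h)
      (by exact_mod_cast congrArg _ hc)

theorem phiNeg_mul_rescale_mul_rescale {w : ℂ} (hw : w ^ 2 + w + 1 = 0) :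
    let φ : ℂ⟦X⟧ := phiNeg.map (Int.castRingHom ℂ)
    φ * rescale w φ * rescale (w ^ 2) φ * expand 9 (by norm_num) φ =
      expand 3 three_ne_zero φ ^ 4 := by
  intro φ
  have hC : (C w : ℂ⟦X⟧) ^ 2 + C w + 1 = 0 := by
    simpa only [map_add, map_pow, map_one, map_zero] using congrArg (C : ℂ →+* ℂ⟦X⟧) hw
  have hnorm (c : ℤ) (hc : c ^ 3 = c) := qProduct_mul_qProduct_mul_qProduct hC hc (dvd_refl X)
  have hgauss (G : ℂ⟦X⟧ →+* ℂ⟦X⟧) (hG : Continuous G) :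
      G φ * qProduct 1 (G X) = qProduct (-1) (G X) := by
    simpa only [RingHom.comp_apply, map_X] using map_phiNeg_mul_qProduct_one
      (G.comp (PowerSeries.map (Int.castRingHom ℂ)))
      (hG.comp (continuous_powerSeries_map continuous_of_discreteTopology))
  have h₁ : φ * qProduct 1 X = qProduct (-1) X := hgauss (RingHom.id _) continuous_id
  have hrescale (z : ℂ) : rescale z φ * qProduct 1 (C z * X) = qProduct (-1) (C z * X) := by
    simpa only [rescale_X] using hgauss (rescale z) (continuous_rescale z)
  have hexpand (p : ℕ) (hp : p ≠ 0) :
      expand p hp φ * qProduct 1 (X ^ p) = qProduct (-1) (X ^ p) := by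
    simpa using hgauss (expand p hp : ℂ⟦X⟧ →ₐ[ℂ] ℂ⟦X⟧).toRingHom (continuous_expand p hp)
  refine mul_right_cancel₀
    (pow_ne_zero 4 (qProduct_ne_zero 1 (dvd_pow_self (X : ℂ⟦X⟧) three_ne_zero))) ?_
  calc φ * rescale w φ * rescale (w ^ 2) φ * expand 9 _ φ * qProduct 1 (X ^ 3) ^ 4
    _ = (φ * qProduct 1 X) * (rescale w φ * qProduct 1 (C w * X)) *
          (rescale (w ^ 2) φ * qProduct 1 (C (w ^ 2) * X)) *
          (expand 9 _ φ * qProduct 1 (X ^ 9)) := by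
      rw [← hnorm 1 (by norm_num), map_pow]
      ring
    _ = qProduct (-1) (X ^ 3) ^ 4 := by
      rw [h₁, hrescale, hrescale, hexpand, map_pow, hnorm (-1) (by norm_num)]
    _ = expand 3 three_ne_zero φ ^ 4 * qProduct 1 (X ^ 3) ^ 4 := by
      rw [← hexpand 3 three_ne_zero, mul_pow]

theorem expand_phiNegCube_mul :
    expand 3 three_ne_zero phiNegCube * (expand 3 three_ne_zero phiNegCube ^ 3 -
      (expand 3 three_ne_zero phiNegCube - phiNeg) ^ 3) = phiNegCube ^ 4 := by
  obtain ⟨w, hw3⟩ : ∃ w : ℂ, IsPrimitiveRoot w 3 :=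
    ⟨_, Complex.isPrimitiveRoot_exp 3 three_ne_zero⟩
  have hw : w ^ 2 + w + 1 = 0 := by
    simpa [Finset.sum_range_succ'] using hw3.geom_sum_eq_zero (by norm_num)
  set A := expand 3 three_ne_zero phiNegCube with hA
  have hcoeff (n : ℕ) (hn : n % 3 ≠ 0) : coeff n A = 0 :=
    coeff_expand_of_not_dvd _ _ _ (by omega)
  have h := mul_rescale_mul_rescale_sub hw (f := A.map (Int.castRingHom ℂ))
    (g := (A - phiNeg).map (Int.castRingHom ℂ)) (fun n hn => by simp [hcoeff n hn]) fun n hn => by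
      rw [coeff_map, coeff_expand_phiNegCube_sub_phiNeg hn, map_zero]
  rw [← map_sub, sub_sub_cancel] at h
  refine map_injective (Int.castRingHom ℂ) Int.cast_injective ?_
  rw [map_mul, map_sub, map_pow, map_pow, ← h, map_pow, hA, phiNegCube, ← expand_mul,
    map_expand, map_expand, ← phiNeg_mul_rescale_mul_rescale hw]
  ring

end CubicRelation

section Filtration

open Pointwise

variable {R : Type*} [CommRing R]

/-- The weight filtration of `ℤ[s]` used to measure divisibility by `3`: giving `s` the weight `-3`
and `3` the weight `2`, it is spanned by the monomials `3 ^ v * s ^ j` of weight at least `c`. -/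
def weightFiltration (s : R) (c : ℤ) : Submodule ℤ R :=
  Submodule.span ℤ {x | ∃ v j : ℕ, 3 * (j : ℤ) + c ≤ 2 * v ∧ x = 3 ^ v * s ^ j}

variable {s : R} {c d : ℤ}

theorem three_pow_mul_pow_mem_weightFiltration {v j : ℕ} (h : 3 * (j : ℤ) + c ≤ 2 * v) :
    3 ^ v * s ^ j ∈ weightFiltration s c :=
  Submodule.subset_span ⟨v, j, h, rfl⟩

theorem mem_weightFiltration_of_eq_sum {x : R} {n : ℕ} (a : Fin n → ℤ) (v : Fin n → ℕ)
    (h : ∀ j : Fin n, 3 * (j : ℤ) + c ≤ 2 * v j)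
    (hx : x = ∑ j : Fin n, (a j : R) * (3 ^ v j * s ^ (j : ℕ))) : x ∈ weightFiltration s c := by
  refine hx ▸ sum_mem fun j _ => ?_
  rw [← zsmul_eq_mul]
  exact Submodule.smul_mem _ _ (three_pow_mul_pow_mem_weightFiltration (h j))

theorem weightFiltration_antitone : Antitone (weightFiltration s) := by
  refine fun c d hcd => Submodule.span_mono ?_
  rintro _ ⟨v, j, h, rfl⟩
  exact ⟨v, j, by linarith, rfl⟩

theorem self_mem_weightFiltration : s ∈ weightFiltration s (-3) := by
  simpa using three_pow_mul_pow_mem_weightFiltration (s := s) (c := -3) (v := 0) (j := 1) le_rfl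

theorem mul_mem_weightFiltration {x y : R} {b : ℤ} (hx : x ∈ weightFiltration s c)
    (hy : y ∈ weightFiltration s d) (hb : b ≤ c + d) : x * y ∈ weightFiltration s b := by
  refine weightFiltration_antitone hb ?_
  have h := Submodule.mul_mem_mul hx hy
  rw [weightFiltration, weightFiltration, Submodule.span_mul_span] at h
  refine Submodule.span_mono ?_ h
  rintro _ ⟨_, ⟨v, j, hvj, rfl⟩, _, ⟨v', j', hvj', rfl⟩, rfl⟩
  exact ⟨v + v', j + j', by push_cast; linarith, by ring⟩

theorem three_pow_dvd_of_mem_weightFiltration {v : ℕ} (hv : 2 * (v : ℤ) ≤ c + 1) {x : R}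
    (hx : x ∈ weightFiltration s c) : 3 ^ v ∣ x := by
  induction hx using Submodule.span_induction with
  | mem x hx =>
    obtain ⟨v', j, h, rfl⟩ := hx
    exact (pow_dvd_pow 3 (by omega)).mul_right _
  | zero => exact dvd_zero _
  | add x y _ _ hx hy => exact dvd_add hx hy
  | smul a x _ hx => exact zsmul_eq_mul x a ▸ hx.mul_left _

theorem mem_smul_weightFiltration_iff {q x : R} :
    x ∈ q • weightFiltration s c ↔ ∃ y ∈ weightFiltration s c, q * y = x :=
  Submodule.mem_smul_pointwise_iff_exists _ _ _

theorem mul_mem_smul_weightFiltration {q x y : R} {b : ℤ} (hx : x ∈ weightFiltration s c)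
    (hy : y ∈ q • weightFiltration s d) (hb : b ≤ c + d) : x * y ∈ q • weightFiltration s b := by
  obtain ⟨z, hz, rfl⟩ := mem_smul_weightFiltration_iff.mp hy
  exact mem_smul_weightFiltration_iff.mpr
    ⟨x * z, mul_mem_weightFiltration hx hz hb, mul_left_comm q x z⟩

theorem self_mul_mem_smul_weightFiltration {q e₁ e₂ e₃ x y z : R}
    (he₁ : e₁ ∈ weightFiltration s 2) (he₂ : e₂ ∈ weightFiltration s 1)
    (he₃ : e₃ ∈ weightFiltration s 0) (hx : x ∈ q • weightFiltration s (c + 1))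
    (hy : y ∈ q • weightFiltration s (c + 2)) (hz : s * z ∈ q • weightFiltration s c) :
    s * (e₁ * x + e₂ * y + e₃ * z) ∈ q • weightFiltration s c := by
  have hse₁ : s * e₁ ∈ weightFiltration s (-1) :=
    mul_mem_weightFiltration self_mem_weightFiltration he₁ (by norm_num)
  have hse₂ : s * e₂ ∈ weightFiltration s (-2) :=
    mul_mem_weightFiltration self_mem_weightFiltration he₂ (by norm_num)
  rw [show s * (e₁ * x + e₂ * y + e₃ * z) = s * e₁ * x + s * e₂ * y + e₃ * (s * z) by ring]
  refine add_mem (add_mem ?_ ?_) ?_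
  · exact mul_mem_smul_weightFiltration hse₁ hx (by omega)
  · exact mul_mem_smul_weightFiltration hse₂ hy (by omega)
  · exact mul_mem_smul_weightFiltration he₃ hz (by omega)

/-- Since `s * eᵢ` has weight at least `-i`, each step of the recurrence costs one unit of
weight. -/
theorem mem_smul_weightFiltration_of_recurrence {q e₁ e₂ e₃ : R} {u : ℕ → R}
    (hu : ∀ k, u (k + 3) = s * (e₁ * u (k + 2) + e₂ * u (k + 1) + e₃ * u k))
    (he₁ : e₁ ∈ weightFiltration s 2) (he₂ : e₂ ∈ weightFiltration s 1)
    (he₃ : e₃ ∈ weightFiltration s 0) (hu₀ : u 0 ∈ q • weightFiltration s c)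
    (hu₁ : u 1 ∈ (q * s) • weightFiltration s (c + 2))
    (hu₂ : u 2 ∈ (q * s) • weightFiltration s (c + 1)) (k : ℕ) :
    u (k + 1) ∈ (q * s) • weightFiltration s (c + 2 - k) := by
  induction k using Nat.strong_induction_on with
  | h k ih =>
    match k, ih with
    | 0, _ => simpa using hu₁
    | 1, _ => rwa [show c + 2 - ((1 : ℕ) : ℤ) = c + 1 by push_cast; ring]
    | k + 2, ih =>
      have hsu : s * u k ∈ (q * s) • weightFiltration s (c - k) := by
        match k, ih with
        | 0, _ =>
          obtain ⟨r, hr, h⟩ := mem_smul_weightFiltration_iff.mp hu₀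
          rw [← h, Nat.cast_zero, sub_zero]
          exact mem_smul_weightFiltration_iff.mpr ⟨r, hr, by ring⟩
        | k + 1, ih =>
          exact mul_mem_smul_weightFiltration self_mem_weightFiltration (ih k (by omega))
            (by omega)
      have h₁ := ih (k + 1) (by omega)
      have h₂ := ih k (by omega)
      rw [show c + 2 - ((k + 1 : ℕ) : ℤ) = c - k + 1 by push_cast; ring] at h₁
      rw [show c + 2 - (k : ℤ) = c - k + 2 by ring] at h₂
      rw [hu, show c + 2 - ((k + 2 : ℕ) : ℤ) = c - k by push_cast; ring]
      exact self_mul_mem_smul_weightFiltration he₁ he₂ he₃ h₁ h₂ hsu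

theorem map_mem_smul_weightFiltration {F : Type*} [FunLike F R R] [AddMonoidHomClass F R R]
    {p q : R} (T : F)
    (hT : ∀ k : ℕ, T (p * s ^ (k + 1)) ∈ (q * s) • weightFiltration s (d - k)) {x : R}
    (hx : x ∈ (p * s) • weightFiltration s c) : T x ∈ (q * s) • weightFiltration s (c + d) := by
  obtain ⟨y, hy, rfl⟩ := mem_smul_weightFiltration_iff.mp hx
  clear hx
  induction hy using Submodule.span_induction with
  | mem y hy =>
    obtain ⟨v, j, h, rfl⟩ := hy
    rw [show p * s * (3 ^ v * s ^ j) = ((3 ^ v : ℕ) : R) * (p * s ^ (j + 1)) by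
      push_cast; ring, ← nsmul_eq_mul, map_nsmul, nsmul_eq_mul]
    have h3 : ((3 ^ v : ℕ) : R) ∈ weightFiltration s (2 * v) := by
      simpa using three_pow_mul_pow_mem_weightFiltration (s := s) (v := v) (j := 0) (by simp)
    exact mul_mem_smul_weightFiltration h3 (hT j) (by omega)
  | zero => simp
  | add y z _ _ hy hz => simpa only [mul_add, map_add] using add_mem hy hz
  | smul a y _ hy => simpa only [mul_smul_comm, map_zsmul] using Submodule.smul_mem _ a hy

end Filtration

section ModularEquation

local notation "P" => ph3Series
local notation "Q" => expand 3 three_ne_zero ph3Series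

theorem phiNeg_ne_zero : phiNeg ≠ 0 := fun h => by
  simpa [h] using constantCoeff_phiNeg

theorem expand_ph3Series_mul_phiNegCube :
    Q * phiNegCube = expand 3 three_ne_zero phiNegCube :=
  (map_mul _ _ _).symm.trans (congrArg (expand 3 three_ne_zero) ph3Series_mul_phiNeg)

theorem constantCoeff_ph3Series : constantCoeff ph3Series = 1 := by
  simpa [phiNegCube, constantCoeff_phiNeg] using congrArg constantCoeff ph3Series_mul_phiNeg

theorem ph3Series_pow_three : P ^ 3 = Q * (3 * Q ^ 2 * P ^ 2 - 3 * Q * P + 1) := by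
  have hP : P ≠ 0 := fun h => by simpa [h] using constantCoeff_ph3Series
  have h := expand_phiNegCube_mul
  rw [← expand_ph3Series_mul_phiNegCube, ← ph3Series_mul_phiNeg] at h
  refine mul_right_cancel₀ (mul_ne_zero hP (pow_ne_zero 4 phiNeg_ne_zero)) ?_
  linear_combination -h

theorem ph3Series_sq_pow_three :
    (P ^ 2) ^ 3 = (9 * Q ^ 6 - 6 * Q ^ 2) * (P ^ 2) ^ 2 - 3 * Q ^ 4 * P ^ 2 + Q ^ 2 := by
  linear_combination (P ^ 3 + 3 * Q ^ 2 * P + 3 * Q ^ 3 * P ^ 2 + Q) * ph3Series_pow_three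

theorem ph3Series_pow_four_pow_three :
    (P ^ 4) ^ 3 = (Q ^ 4 * (9 * Q ^ 4 - 6) ^ 2 - 6 * Q ^ 4) * (P ^ 4) ^ 2 +
      (18 * Q ^ 8 - 12 * Q ^ 4 - 9 * Q ^ 8) * P ^ 4 + Q ^ 4 := by
  linear_combination (P ^ 6 + 3 * Q ^ 4 * P ^ 2 + Q ^ 2 * (1 + (9 * Q ^ 4 - 6) * P ^ 4)) *
    ph3Series_sq_pow_three

/-- The modular function `s = P ^ 4 - 1`, where `P = φ(-q^3) / φ(-q)`: it is a Hauptmodul of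
`Γ₀(6)`, and `U_3` maps each of `P ℤ[s]` and `P ^ 3 ℤ[s]` into the other. -/
noncomputable def ph3Hauptmodul : ℤ⟦X⟧ :=
  P ^ 4 - 1

theorem ph3Hauptmodul_pow_three :
    let s := ph3Hauptmodul
    let t := expand 3 three_ne_zero s
    s ^ 3 = t * (57 + 135 * t + 81 * t ^ 2) * s ^ 2 + t * (120 + 279 * t + 162 * t ^ 2) * s +
      t * (64 + 144 * t + 81 * t ^ 2) := by
  simp only [ph3Hauptmodul, map_sub, map_pow, map_one]
  linear_combination ph3Series_pow_four_pow_three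

end ModularEquation

section Values

local notation "P" => ph3Series
local notation "U₃" => (atkinU 3 : ℤ⟦X⟧ →ₗ[ℤ] ℤ⟦X⟧)

theorem exists_mul_ph3Series_eq_one :
    ∃ z : ℤ⟦X⟧, z * P = 1 ∧ U₃ z = P ∧ U₃ (z ^ 2) = P ^ 2 := by
  obtain ⟨z, hz⟩ := (isUnit_iff_constantCoeff.mpr
    (constantCoeff_ph3Series ▸ isUnit_one)).exists_left_inv
  have hzφ : phiNegCube * z = phiNeg := by
    linear_combination phiNeg * hz - z * ph3Series_mul_phiNeg
  refine ⟨z, hz, mul_left_cancel₀ phiNeg_ne_zero ?_,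
    mul_left_cancel₀ (pow_ne_zero 2 phiNeg_ne_zero) ?_⟩
  · calc phiNeg * U₃ z = U₃ (phiNegCube * z) := (atkinU_expand_mul 3 three_ne_zero _ _).symm
      _ = phiNeg * P := by rw [hzφ, atkinU_phiNeg, ← ph3Series_mul_phiNeg, mul_comm]
  · calc phiNeg ^ 2 * U₃ (z ^ 2) = U₃ (phiNegCube ^ 2 * z ^ 2) := by
          rw [← atkinU_expand_mul 3 three_ne_zero, map_pow, phiNegCube]
      _ = phiNeg ^ 2 * P ^ 2 := by
          rw [← mul_pow, hzφ, atkinU_phiNeg_sq, ← ph3Series_mul_phiNeg, mul_pow, mul_comm]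

theorem atkinU_mul_ph3Series_pow_add_three (x : ℤ⟦X⟧) (k : ℕ) :
    U₃ (x * P ^ (k + 3)) = 3 * P ^ 3 * U₃ (x * P ^ (k + 2)) - 3 * P ^ 2 * U₃ (x * P ^ (k + 1)) +
      P * U₃ (x * P ^ k) := by
  have h := atkinU_mul_pow_add_three (hp := three_ne_zero) (a := 3 * P ^ 3) (b := -3 * P ^ 2)
    (c := P) (y := P) (by
      simp only [map_mul, map_pow, map_neg, map_ofNat]
      linear_combination ph3Series_pow_three) x k
  linear_combination h

theorem atkinU_mul_ph3Series_sq_pow_add_three (x : ℤ⟦X⟧) (k : ℕ) :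
    U₃ (x * (P ^ 2) ^ (k + 3)) = (9 * P ^ 6 - 6 * P ^ 2) * U₃ (x * (P ^ 2) ^ (k + 2)) -
      3 * P ^ 4 * U₃ (x * (P ^ 2) ^ (k + 1)) + P ^ 2 * U₃ (x * (P ^ 2) ^ k) := by
  have h := atkinU_mul_pow_add_three (hp := three_ne_zero) (a := 9 * P ^ 6 - 6 * P ^ 2)
    (b := -3 * P ^ 4) (c := P ^ 2) (y := P ^ 2) (by
      simp only [map_sub, map_mul, map_pow, map_neg, map_ofNat]
      linear_combination ph3Series_sq_pow_three) x k
  linear_combination h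

theorem atkinU_ph3Series : U₃ P = P ^ 3 := by
  obtain ⟨z, hzP, hz, hz2⟩ := exists_mul_ph3Series_eq_one
  have h := atkinU_mul_ph3Series_pow_add_three (z ^ 2) 0
  rw [show z ^ 2 * P ^ (0 + 3) = P by linear_combination P * (z * P + 1) * hzP,
    show z ^ 2 * P ^ (0 + 2) = 1 by linear_combination (z * P + 1) * hzP,
    show z ^ 2 * P ^ (0 + 1) = z by linear_combination z * hzP, pow_zero, mul_one,
    atkinU_one three_ne_zero, hz, hz2] at h
  linear_combination h

theorem atkinU_ph3Series_sq : U₃ (P ^ 2) = 3 * P ^ 6 - 2 * P ^ 2 := by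
  obtain ⟨z, hzP, hz, -⟩ := exists_mul_ph3Series_eq_one
  have h := atkinU_mul_ph3Series_pow_add_three z 0
  rw [show z * P ^ (0 + 3) = P ^ 2 by linear_combination P ^ 2 * hzP,
    show z * P ^ (0 + 2) = P by linear_combination P * hzP,
    show z * P ^ (0 + 1) = 1 by linear_combination hzP, pow_zero, mul_one,
    atkinU_one three_ne_zero, hz, atkinU_ph3Series] at h
  linear_combination h

theorem atkinU_ph3Series_pow_three : U₃ (P ^ 3) = P - 9 * P ^ 5 + 9 * P ^ 9 := by
  have h := atkinU_mul_ph3Series_pow_add_three 1 0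
  simp only [one_mul, zero_add, pow_zero, pow_one, atkinU_ph3Series, atkinU_ph3Series_sq,
    atkinU_one three_ne_zero] at h
  linear_combination h

theorem atkinU_ph3Series_pow_two_mul_add_seven (k : ℕ) :
    U₃ (P ^ (2 * k + 7)) = (9 * P ^ 6 - 6 * P ^ 2) * U₃ (P ^ (2 * k + 5)) -
      3 * P ^ 4 * U₃ (P ^ (2 * k + 3)) + P ^ 2 * U₃ (P ^ (2 * k + 1)) := by
  convert atkinU_mul_ph3Series_sq_pow_add_three P k using 6 <;> ring

theorem atkinU_ph3Series_pow_five :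
    U₃ (P ^ 5) = -5 * P ^ 3 + 60 * P ^ 7 - 135 * P ^ 11 + 81 * P ^ 15 := by
  obtain ⟨z, hzP, hz, -⟩ := exists_mul_ph3Series_eq_one
  have h := atkinU_mul_ph3Series_sq_pow_add_three z 0
  rw [show z * (P ^ 2) ^ (0 + 3) = P ^ 5 by linear_combination P ^ 5 * hzP,
    show z * (P ^ 2) ^ (0 + 2) = P ^ 3 by linear_combination P ^ 3 * hzP,
    show z * (P ^ 2) ^ (0 + 1) = P by linear_combination P * hzP, pow_zero, mul_one,
    hz, atkinU_ph3Series, atkinU_ph3Series_pow_three] at h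
  linear_combination h

theorem atkinU_ph3Series_pow_seven :
    U₃ (P ^ 7) = 28 * P ^ 5 - 378 * P ^ 9 + 1323 * P ^ 13 - 1701 * P ^ 17 + 729 * P ^ 21 := by
  have h := atkinU_ph3Series_pow_two_mul_add_seven 0
  simp only [mul_zero, zero_add, pow_one, atkinU_ph3Series, atkinU_ph3Series_pow_three,
    atkinU_ph3Series_pow_five] at h
  linear_combination h

theorem atkinU_ph3Series_pow_nine :
    U₃ (P ^ 9) = P ^ 3 - 162 * P ^ 7 + 2349 * P ^ 11 - 10935 * P ^ 15 + 21870 * P ^ 19 -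
      19683 * P ^ 23 + 6561 * P ^ 27 := by
  have h := atkinU_ph3Series_pow_two_mul_add_seven 1
  simp only [mul_one, Nat.reduceAdd, atkinU_ph3Series_pow_three, atkinU_ph3Series_pow_five,
    atkinU_ph3Series_pow_seven] at h
  linear_combination h

theorem atkinU_ph3Series_pow_eleven :
    U₃ (P ^ 11) = -11 * P ^ 5 + 957 * P ^ 9 - 14553 * P ^ 13 + 82863 * P ^ 17 - 224532 * P ^ 21 +
      312741 * P ^ 25 - 216513 * P ^ 29 + 59049 * P ^ 33 := by
  have h := atkinU_ph3Series_pow_two_mul_add_seven 2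
  simp only [Nat.reduceMul, Nat.reduceAdd, atkinU_ph3Series_pow_five, atkinU_ph3Series_pow_seven,
    atkinU_ph3Series_pow_nine] at h
  linear_combination h

end Values

section Congruence

open Pointwise

local notation "P" => ph3Series
local notation "s" => ph3Hauptmodul
local notation "U₃" => (atkinU 3 : ℤ⟦X⟧ →ₗ[ℤ] ℤ⟦X⟧)
local notation "W" => weightFiltration ph3Hauptmodul

theorem atkinU_mul_ph3Hauptmodul_pow_add_three (x : ℤ⟦X⟧) (k : ℕ) :
    U₃ (x * s ^ (k + 3)) = s * ((57 + 135 * s + 81 * s ^ 2) * U₃ (x * s ^ (k + 2)) +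
      (120 + 279 * s + 162 * s ^ 2) * U₃ (x * s ^ (k + 1)) +
      (64 + 144 * s + 81 * s ^ 2) * U₃ (x * s ^ k)) := by
  have h := atkinU_mul_pow_add_three (hp := three_ne_zero) (a := s * (57 + 135 * s + 81 * s ^ 2))
    (b := s * (120 + 279 * s + 162 * s ^ 2)) (c := s * (64 + 144 * s + 81 * s ^ 2)) (y := s) (by
      simp only [map_add, map_mul, map_pow, map_ofNat]
      exact ph3Hauptmodul_pow_three) x k
  linear_combination h

theorem atkinU_mul_ph3Hauptmodul_pow_mem {p q : ℤ⟦X⟧} {c : ℤ} (h₀ : U₃ p ∈ q • W c)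
    (h₁ : U₃ (p * s) ∈ (q * s) • W (c + 2)) (h₂ : U₃ (p * s ^ 2) ∈ (q * s) • W (c + 1)) (k : ℕ) :
    U₃ (p * s ^ (k + 1)) ∈ (q * s) • W (c + 2 - k) := by
  refine mem_smul_weightFiltration_of_recurrence (u := fun k => U₃ (p * s ^ k))
    (atkinU_mul_ph3Hauptmodul_pow_add_three p) ?_ ?_ ?_ (by simpa using h₀) (by simpa using h₁)
    h₂ k
  · refine mem_weightFiltration_of_eq_sum ![19, 5, 1] ![1, 3, 4] (by decide) ?_
    simp [Fin.sum_univ_succ]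
    ring
  · refine mem_weightFiltration_of_eq_sum ![40, 31, 2] ![1, 2, 4] (by decide) ?_
    simp [Fin.sum_univ_succ]
    ring
  · refine mem_weightFiltration_of_eq_sum ![64, 16, 1] ![0, 2, 4] (by decide) ?_
    simp [Fin.sum_univ_succ]
    ring

theorem atkinU_ph3Series_mul_ph3Hauptmodul :
    U₃ (P * s) = P ^ 3 * s * (33 + 108 * s + 81 * s ^ 2) := by
  rw [show P * s = P ^ 5 - P by rw [ph3Hauptmodul]; ring, map_sub, atkinU_ph3Series_pow_five,
    atkinU_ph3Series, ph3Hauptmodul]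
  ring

theorem atkinU_ph3Series_mul_ph3Hauptmodul_sq :
    U₃ (P * s ^ 2) = P ^ 3 * s * (96 + 2133 * s + 10773 * s ^ 2 + 21870 * s ^ 3 + 19683 * s ^ 4 +
      6561 * s ^ 5) := by
  rw [show P * s ^ 2 = P ^ 9 - (2 : ℤ) • P ^ 5 + P by
      rw [ph3Hauptmodul, zsmul_eq_mul]; push_cast; ring,
    map_add, map_sub, map_smul, atkinU_ph3Series_pow_nine, atkinU_ph3Series_pow_five,
    atkinU_ph3Series, ph3Hauptmodul, zsmul_eq_mul]
  push_cast
  ring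

theorem atkinU_ph3Series_pow_three_mul_ph3Hauptmodul :
    U₃ (P ^ 3 * s) = P * s * (73 + 666 * s + 1809 * s ^ 2 + 1944 * s ^ 3 + 729 * s ^ 4) := by
  rw [show P ^ 3 * s = P ^ 7 - P ^ 3 by rw [ph3Hauptmodul]; ring, map_sub,
    atkinU_ph3Series_pow_seven, atkinU_ph3Series_pow_three, ph3Hauptmodul]
  ring

theorem atkinU_ph3Series_pow_three_mul_ph3Hauptmodul_sq :
    U₃ (P ^ 3 * s ^ 2) = P * s * (128 + 5529 * s + 51570 * s ^ 2 + 202905 * s ^ 3 +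
      410427 * s ^ 4 + 450522 * s ^ 5 + 255879 * s ^ 6 + 59049 * s ^ 7) := by
  rw [show P ^ 3 * s ^ 2 = P ^ 11 - (2 : ℤ) • P ^ 7 + P ^ 3 by
      rw [ph3Hauptmodul, zsmul_eq_mul]; push_cast; ring,
    map_add, map_sub, map_smul, atkinU_ph3Series_pow_eleven, atkinU_ph3Series_pow_seven,
    atkinU_ph3Series_pow_three, ph3Hauptmodul, zsmul_eq_mul]
  push_cast
  ring

theorem atkinU_ph3Series_mul_ph3Hauptmodul_pow_mem (k : ℕ) :
    U₃ (P * s ^ (k + 1)) ∈ (P ^ 3 * s) • W (2 - k) := by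
  refine zero_add (2 : ℤ) ▸ atkinU_mul_ph3Hauptmodul_pow_mem (c := 0) ?_ ?_ ?_ k
  · rw [atkinU_ph3Series]
    refine mem_smul_weightFiltration_iff.mpr ⟨1, ?_, mul_one _⟩
    exact mem_weightFiltration_of_eq_sum ![1] ![0] (by decide) (by simp)
  · rw [atkinU_ph3Series_mul_ph3Hauptmodul]
    refine mem_smul_weightFiltration_iff.mpr ⟨_, mem_weightFiltration_of_eq_sum
      ![11, 4, 1] ![1, 3, 4] (by decide) ?_, rfl⟩
    simp [Fin.sum_univ_succ]
    ring
  · rw [atkinU_ph3Series_mul_ph3Hauptmodul_sq]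
    refine mem_smul_weightFiltration_iff.mpr ⟨_, mem_weightFiltration_of_eq_sum
      ![32, 79, 133, 10, 1, 1] ![1, 3, 4, 7, 9, 8] (by decide) ?_, rfl⟩
    simp [Fin.sum_univ_succ]
    ring

theorem atkinU_ph3Series_pow_three_mul_ph3Hauptmodul_pow_mem (k : ℕ) :
    U₃ (P ^ 3 * s ^ (k + 1)) ∈ (P * s) • W (0 - k) := by
  refine neg_add_cancel (2 : ℤ) ▸ atkinU_mul_ph3Hauptmodul_pow_mem (c := -2) ?_ ?_ ?_ k
  · rw [atkinU_ph3Series_pow_three, show P - 9 * P ^ 5 + 9 * P ^ 9 = P * (1 + 9 * s + 9 * s ^ 2) by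
        rw [ph3Hauptmodul]; ring]
    refine mem_smul_weightFiltration_iff.mpr ⟨_, mem_weightFiltration_of_eq_sum
      ![1, 1, 1] ![0, 2, 2] (by decide) ?_, rfl⟩
    simp [Fin.sum_univ_succ]
    ring
  · rw [atkinU_ph3Series_pow_three_mul_ph3Hauptmodul]
    refine mem_smul_weightFiltration_iff.mpr ⟨_, mem_weightFiltration_of_eq_sum
      ![73, 74, 67, 8, 1] ![0, 2, 3, 5, 6] (by decide) ?_, rfl⟩
    simp [Fin.sum_univ_succ]
    ring
  · rw [atkinU_ph3Series_pow_three_mul_ph3Hauptmodul_sq]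
    refine mem_smul_weightFiltration_iff.mpr ⟨_, mem_weightFiltration_of_eq_sum
      ![128, 1843, 1910, 835, 563, 206, 13, 1] ![0, 1, 3, 5, 6, 7, 9, 10] (by decide) ?_, rfl⟩
    simp [Fin.sum_univ_succ]
    ring

theorem atkinU_pow_three_sub_atkinU_ph3Series_mem :
    (U₃ ^ 3) P - (U₃ ^ 1) P ∈ (P ^ 3 * s) • W 5 := by
  have hU : (U₃ ^ 3) P - (U₃ ^ 1) P = 9 * (U₃ (P * s ^ (0 + 1)) + U₃ (P * s ^ (1 + 1))) := by
    have hUU : U₃ (U₃ P) = P + (9 : ℤ) • (P * s ^ (0 + 1) + P * s ^ (1 + 1)) := by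
      rw [atkinU_ph3Series, atkinU_ph3Series_pow_three, ph3Hauptmodul, zsmul_eq_mul]
      push_cast
      ring
    rw [pow_one, pow_succ', Module.End.mul_apply, sq, Module.End.mul_apply, hUU, map_add,
      map_smul, map_add, zsmul_eq_mul, add_sub_cancel_left]
    norm_cast
  have h9 : (9 : ℤ⟦X⟧) ∈ W 4 := by
    refine mem_weightFiltration_of_eq_sum ![1] ![2] (by decide) ?_
    norm_num
  rw [hU, mul_add]
  exact add_mem
    (mul_mem_smul_weightFiltration h9 (atkinU_ph3Series_mul_ph3Hauptmodul_pow_mem 0) (by norm_num))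
    (mul_mem_smul_weightFiltration h9 (atkinU_ph3Series_mul_ph3Hauptmodul_pow_mem 1) (by norm_num))

theorem atkinU_pow_sub_atkinU_pow_ph3Series_mem (m : ℕ) :
    (U₃ ^ (2 * m + 3)) P - (U₃ ^ (2 * m + 1)) P ∈ (P ^ 3 * s) • W (2 * m + 5) := by
  induction m with
  | zero => simpa using atkinU_pow_three_sub_atkinU_ph3Series_mem
  | succ m ih =>
    have hsub : (U₃ ^ (2 * (m + 1) + 3)) P - (U₃ ^ (2 * (m + 1) + 1)) P =
        U₃ (U₃ ((U₃ ^ (2 * m + 3)) P - (U₃ ^ (2 * m + 1)) P)) := by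
      simp only [map_sub, ← Module.End.mul_apply, ← pow_succ']
      rfl
    rw [hsub, show 2 * ((m + 1 : ℕ) : ℤ) + 5 = 2 * m + 5 + 0 + 2 by push_cast; ring]
    exact map_mem_smul_weightFiltration U₃ atkinU_ph3Series_mul_ph3Hauptmodul_pow_mem
      (map_mem_smul_weightFiltration U₃ atkinU_ph3Series_pow_three_mul_ph3Hauptmodul_pow_mem ih)

theorem three_pow_dvd_atkinU_pow_sub_atkinU_pow_ph3Series (m : ℕ) :
    3 ^ (m + 3) ∣ (U₃ ^ (2 * m + 3)) P - (U₃ ^ (2 * m + 1)) P := by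
  obtain ⟨x, hx, h⟩ := mem_smul_weightFiltration_iff.mp
    (atkinU_pow_sub_atkinU_pow_ph3Series_mem m)
  rw [← h]
  exact (three_pow_dvd_of_mem_weightFiltration (by push_cast; linarith) hx).mul_left _

end Congruence

theorem theorem1p1 (m n : ℕ) (hm : 1 ≤ m) :
    ph3 (3 ^ (2 * m + 1) * n) ≡ ph3 (3 ^ (2 * m - 1) * n) [ZMOD 3 ^ (m + 2)] := by
  obtain ⟨m, rfl⟩ := Nat.exists_eq_add_of_le' hm
  obtain ⟨f, hf⟩ := three_pow_dvd_atkinU_pow_sub_atkinU_pow_ph3Series m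
  have h3 : (3 : ℤ⟦X⟧) ^ (m + 3) = C (3 ^ (m + 3)) := by simp
  have hcoeff := congrArg (coeff n) hf
  rw [map_sub, coeff_atkinU_pow, coeff_atkinU_pow, h3, coeff_C_mul] at hcoeff
  exact (Int.modEq_iff_dvd.mpr ⟨coeff n f, hcoeff⟩).symm
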